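/- For elements $a,q$ of a ring put $(a;q)_n=\prod_{j=1}^{n}(1-aq^{j-1})$ and $(a;q)_\infty=\prod_{j\ge 1}(1-aq^{j-1})$. As an identity of formal power series in $q$ with coefficients in $\mathbb{Z}[a,b]$ (hence also for arbitrary elements $a,b$ of any commutative ring $R$, in $R[[q]]$), where infinite sums and products converge coefficientwise, $$\sum_{n_{11},n_{12},n_{10},n_{21},n_{22}\ge 0}\frac{q^{E(n_{21},n_{22},n_{11},n_{12},n_{10})}\;a^{2n_{21}+n_{11}+n_{10}}\;b^{2n_{22}+n_{12}+n_{10}}}{(q^3;q^3)_{n_{11}}(q^3;q^3)_{n_{12}}(q^3;q^3)_{n_{10}}(q^6;q^6)_{n_{21}}(q^6;q^6)_{n_{22}}}=(-aq;q^3)_\infty\,(-bq^2;q^3)_\infty,$$ where $$\begin{aligned}E(n_{21},n_{22},n_{11},n_{12},n_{10})={}&6n_{21}^2-n_{21}+6n_{22}^2+n_{22}+3n_{11}^2-2n_{11}+3n_{12}^2-n_{12}+3n_{10}^2\\&+12n_{21}n_{22}+6(n_{21}+n_{22})(n_{11}+n_{12}+n_{10})+3n_{11}n_{12}+3n_{11}n_{10}+3n_{12}n_{10}.\end{aligned}$$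 -/

import Mathlib

open scoped PowerSeries PowerSeries.WithPiTopology

namespace SchurSeries

/-- The finite `q`-shifted factorial `(a; q)_n = ∏_{j = 1}^n (1 - a q^{j-1})`. -/
def qPoch {A : Type*} [CommRing A] (a q : A) (n : ℕ) : A :=
  ∏ j ∈ Finset.range n, (1 - a * q ^ j)

/-- The infinite `q`-shifted factorial `(a; q)_∞ = ∏_{j ≥ 1} (1 - a q^{j-1})`. It is meaningful
when the family of factors is `Multipliable`. -/
noncomputable def qPochInf {A : Type*} [CommRing A] [TopologicalSpace A] (a q : A) : A :=
  ∏' j : ℕ, (1 - a * q ^ j)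

/-- The exponent of `q` in the numerator of the five-fold series. -/
def qExponent (n21 n22 n11 n12 n10 : ℕ) : ℕ :=
  (6 * n21 ^ 2 - n21) + (6 * n22 ^ 2 + n22)
    + (3 * n11 ^ 2 - 2 * n11) + (3 * n12 ^ 2 - n12) + 3 * n10 ^ 2
    + 12 * n21 * n22 + 6 * (n21 + n22) * (n11 + n12 + n10)
    + 3 * n11 * n12 + 3 * n11 * n10 + 3 * n12 * n10

/-- No natural-number subtraction in `qExponent` is truncated. -/
theorem qExponent_cast (n21 n22 n11 n12 n10 : ℕ) :
    (qExponent n21 n22 n11 n12 n10 : ℤ) =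
      6 * (n21 : ℤ) ^ 2 - n21 + 6 * (n22 : ℤ) ^ 2 + n22
        + 3 * (n11 : ℤ) ^ 2 - 2 * n11 + 3 * (n12 : ℤ) ^ 2 - n12 + 3 * (n10 : ℤ) ^ 2
        + 12 * n21 * n22 + 6 * (n21 + n22) * (n11 + n12 + n10)
        + 3 * n11 * n12 + 3 * n11 * n10 + 3 * n12 * n10 := by
  have h1 : n21 ≤ 6 * n21 ^ 2 := by nlinarith [Nat.le_self_pow two_ne_zero n21]
  have h2 : 2 * n11 ≤ 3 * n11 ^ 2 := by nlinarith [Nat.le_self_pow two_ne_zero n11]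
  have h3 : n12 ≤ 3 * n12 ^ 2 := by nlinarith [Nat.le_self_pow two_ne_zero n12]
  unfold qExponent
  push_cast [Nat.cast_sub h1, Nat.cast_sub h2, Nat.cast_sub h3]
  ring

/-- The denominator
`(q³;q³)_{n11} (q³;q³)_{n12} (q³;q³)_{n10} (q⁶;q⁶)_{n21} (q⁶;q⁶)_{n22}`, a formal power series
in `q` (the variable `X`). -/
noncomputable def denom (R : Type*) [CommRing R] (n21 n22 n11 n12 n10 : ℕ) : R⟦X⟧ :=
  let q : R⟦X⟧ := PowerSeries.X
  qPoch (q ^ 3) (q ^ 3) n11 * qPoch (q ^ 3) (q ^ 3) n12 * qPoch (q ^ 3) (q ^ 3) n10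
    * qPoch (q ^ 6) (q ^ 6) n21 * qPoch (q ^ 6) (q ^ 6) n22

/-- The reciprocal of `denom` in the ring of formal power series. -/
noncomputable def denomInv (R : Type*) [CommRing R] (n21 n22 n11 n12 n10 : ℕ) : R⟦X⟧ :=
  PowerSeries.invOfUnit (denom R n21 n22 n11 n12 n10) 1

/-- `denomInv` really is the reciprocal of `denom`. -/
theorem denom_mul_denomInv (R : Type*) [CommRing R] (n21 n22 n11 n12 n10 : ℕ) :
    denom R n21 n22 n11 n12 n10 * denomInv R n21 n22 n11 n12 n10 = 1 := by
  apply PowerSeries.mul_invOfUnit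
  simp [denom, qPoch, map_prod]

/-- The general term of the five-fold series, indexed by `(n21, n22, n11, n12, n10)`: each
`0 (mod 3)` singleton carries the weight `ab`. -/
noncomputable def seriesTerm {R : Type*} [CommRing R] (a b : R) : ℕ × ℕ × ℕ × ℕ × ℕ → R⟦X⟧ :=
  fun (n21, n22, n11, n12, n10) =>
    PowerSeries.C (a ^ (2 * n21 + n11 + n10) * b ^ (2 * n22 + n12 + n10))
      * PowerSeries.X ^ qExponent n21 n22 n11 n12 n10
      * denomInv R n21 n22 n11 n12 n10

end SchurSeries

/-! Put Q = q³, s = 2n₂₁ + n₁₁, t = 2n₂₂ + n₁₂, m = n₁₀, A = s + m, B = t + m. The exponent becomes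
A + 2B + 3(C(A,2) + C(B,2) + C(n₁₁,2) + C(n₁₂,2) + st) (`qExponent_eq`), so the series can be summed
in three stages. With s, t, m fixed, the sums over (n₂₁, n₁₁) and (n₂₂, n₁₂) separate and give
1/(Q;Q)_s and 1/(Q;Q)_t (`sum_halves_invPoch`). With A, B fixed, the sum over m is a q-Vandermonde
sum equal to 1/((Q;Q)_A (Q;Q)_B) (`sum_antidiagonal_invPoch`). What remains is the product of
Euler's series for (-aq;Q)_∞ and (-bq²;Q)_∞ (`hasSum_eulerTerm`). -/

namespace SchurSeries

open Finset PowerSeries Filter Topology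

/-! ### Finite q-series identities -/

section Algebra

variable {A : Type*} [CommRing A]

theorem qPoch_zero (a q : A) : qPoch a q 0 = 1 := by simp [qPoch]

theorem qPoch_succ (q : A) (n : ℕ) : qPoch q q (n + 1) = qPoch q q n * (1 - q ^ (n + 1)) := by
  simp [qPoch, prod_range_succ, pow_succ']

/-- `p n` is the reciprocal of `(q; q)_n`, expressed by its recursion. -/
structure IsInvPoch (q : A) (p : ℕ → A) : Prop where
  zero : p 0 = 1
  succ : ∀ n, (1 - q ^ (n + 1)) * p (n + 1) = p n

theorem isInvPoch_of_mul_eq_one {q : A} {p : ℕ → A} (h : ∀ n, qPoch q q n * p n = 1) :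
    IsInvPoch q p where
  zero := by simpa [qPoch_zero] using h 0
  succ n := by
    have h1 := h (n + 1)
    have h2 := h n
    rw [qPoch_succ] at h1
    linear_combination p n * h1 - (1 - q ^ (n + 1)) * p (n + 1) * h2

/-- The recursion `(1 - q ^ (n + 1)) g (n + 1) = g n` determines `g` from `g 0`. -/
theorem eq_mul_of_recursion {q : A} {p g : ℕ → A} (h : ∀ n, qPoch q q n * p n = 1)
    (hg : ∀ n, (1 - q ^ (n + 1)) * g (n + 1) = g n) (n : ℕ) : g n = g 0 * p n := by
  have hp := isInvPoch_of_mul_eq_one h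
  induction n with
  | zero => simp [hp.zero]
  | succ n ih =>
    -- The factor `1 - q ^ (n + 1)` divides a unit, so it can be cancelled even if `A` has zero
    -- divisors.
    have h1 : (1 - q ^ (n + 1)) * (qPoch q q n * p (n + 1)) = 1 := by
      have := h (n + 1)
      rw [qPoch_succ] at this
      linear_combination this
    have h2 : (1 - q ^ (n + 1)) * (g (n + 1) - g 0 * p (n + 1)) = 0 := by
      linear_combination hg n + ih - g 0 * hp.succ n
    linear_combination (qPoch q q n * p (n + 1)) * h2 - (g (n + 1) - g 0 * p (n + 1)) * h1

/-- The pairs `(i, k)` with `2 i + k = n`. -/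
def halves (n : ℕ) : Finset (ℕ × ℕ) :=
  (range (n + 1) ×ˢ range (n + 1)).filter fun x => 2 * x.1 + x.2 = n

theorem mem_halves {n : ℕ} {x : ℕ × ℕ} : x ∈ halves n ↔ 2 * x.1 + x.2 = n := by
  simp only [halves, mem_filter, mem_product, mem_range]
  omega

theorem sum_halves (f g : ℕ → A) (n : ℕ) :
    ∑ x ∈ halves n, f x.1 * g x.2 =
      ∑ x ∈ antidiagonal n, (if Even x.1 then f (x.1 / 2) else 0) * g x.2 := by
  simp only [ite_mul, zero_mul]
  rw [← sum_filter]
  refine sum_nbij' (fun x => (2 * x.1, x.2)) (fun x => (x.1 / 2, x.2)) ?_ ?_ ?_ ?_ ?_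
  · rintro ⟨i, k⟩ h
    simpa [mem_halves] using h
  · rintro ⟨i, k⟩ h
    simp only [mem_filter, HasAntidiagonal.mem_antidiagonal, mem_halves] at h ⊢
    rw [Nat.two_mul_div_two_of_even h.2, h.1]
  · simp
  · rintro ⟨i, k⟩ h
    simp only [mem_filter] at h
    simp [Nat.two_mul_div_two_of_even h.2]
  · simp

/-- Coefficientwise form of (-z;q)_∞ / (z²;q²)_∞ = 1/(z;q)_∞. Here `H` plays 1/(z²;q²)_∞ and `E`
plays (-z;q)_∞, with z an auxiliary variable over `A`. Only their functional equations under z ↦ qz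
are used, so no infinite product is needed. -/
theorem sum_halves_invPoch {q : A} {p r : ℕ → A} (hp : ∀ n, qPoch q q n * p n = 1)
    (hr : ∀ n, qPoch (q ^ 2) (q ^ 2) n * r n = 1) (n : ℕ) :
    ∑ x ∈ halves n, r x.1 * (q ^ x.2.choose 2 * p x.2) = p n := by
  have hp' := isInvPoch_of_mul_eq_one hp
  have hr' := isInvPoch_of_mul_eq_one hr
  rw [sum_halves r (fun k => q ^ k.choose 2 * p k)]
  let H : A⟦X⟧ := mk fun n => if Even n then r (n / 2) else 0
  let E : A⟦X⟧ := mk fun k => q ^ k.choose 2 * p k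
  have hH : (1 - X ^ 2) * H = rescale q H := by
    ext n
    rw [sub_mul, one_mul, map_sub, coeff_rescale, coeff_X_pow_mul']
    rcases n with _ | _ | n
    · simp [H]
    · simp [H]
    · have e : (n + 1 + 1) / 2 = n / 2 + 1 := by omega
      by_cases hn : Even n
      · have hn' : Even (n + 1 + 1) := by simpa [Nat.even_add_one] using hn
        have := hr'.succ (n / 2)
        rw [← pow_mul, mul_add, Nat.two_mul_div_two_of_even hn] at this
        simp only [H, coeff_mk, hn', if_true, e]
        simp only [le_add_iff_nonneg_left, zero_le, if_true, Nat.add_sub_cancel, add_assoc,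
          Nat.reduceAdd, hn]
        linear_combination this
      · have hn' : ¬ Even (n + 1 + 1) := by simpa [Nat.even_add_one] using hn
        simp [H, hn, hn', add_assoc]
  have hE : E = (1 + X) * rescale q E := by
    ext n
    rw [add_mul, one_mul, map_add, coeff_rescale]
    rcases n with _ | n
    · simp [E]
    · rw [coeff_succ_X_mul, coeff_rescale]
      simp only [E, coeff_mk]
      rw [← hp'.succ n, Nat.choose_succ_succ' n 1, Nat.choose_one_right]
      ring
  have hG : ∀ n, (1 - q ^ (n + 1)) * coeff (n + 1) (H * E) = coeff n (H * E) := by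
    intro n
    have h : (1 - X) * (H * E) = rescale q (H * E) := by
      rw [map_mul, ← hH]
      nth_rewrite 1 [hE]
      ring
    have h' := congrArg (coeff (n + 1)) h
    rw [sub_mul, one_mul, map_sub, coeff_succ_X_mul, coeff_rescale] at h'
    linear_combination h'
  have := eq_mul_of_recursion (g := fun n => coeff n (H * E)) hp hG n
  simp only [coeff_mul, H, E, coeff_mk] at this
  rw [this]
  simp [hp'.zero, hr'.zero]

/-- With `b` fixed, the left side satisfies the recursion in `a` that characterises 1/(q;q)_a up to
its value at `a = 0`. -/
theorem sum_antidiagonal_invPoch {q : A} {p : ℕ → A} (hp : ∀ n, qPoch q q n * p n = 1)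
    (a b : ℕ) :
    ∑ x ∈ antidiagonal a, (if x.1 ≤ b then q ^ (x.2 * (b - x.1)) * p x.1 * p x.2 * p (b - x.1)
      else 0) = p a * p b := by
  have hp' := isInvPoch_of_mul_eq_one hp
  let t : ℕ → ℕ → A := fun m s => if m ≤ b then q ^ (s * (b - m)) * p m * p s * p (b - m) else 0
  have h1 (m s : ℕ) : (1 - q ^ (s + 1)) * t m (s + 1) = q ^ (b - m) * t m s := by
    simp only [t]
    split_ifs
    · rw [← hp'.succ s]; ring
    · simp
  have h2 (m s : ℕ) : q ^ s * (1 - q ^ (m + 1)) * t (m + 1) s = (1 - q ^ (b - m)) * t m s := by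
    simp only [t]
    by_cases h : m + 1 ≤ b
    · obtain ⟨c, rfl⟩ := Nat.exists_eq_add_of_le h
      have e1 : m + 1 + c - (m + 1) = c := by omega
      have e2 : m + 1 + c - m = c + 1 := by omega
      rw [if_pos h, if_pos (by omega), e1, e2, ← hp'.succ m, ← hp'.succ c]
      ring
    -- Boundary: at `m = b` the factor 1 - q⁰ vanishes, and beyond it `t m s` does.
    · rw [if_neg h]
      split_ifs
      · simp [show b - m = 0 by omega]
      · simp
  have hG : ∀ n, (1 - q ^ (n + 1)) * ∑ x ∈ antidiagonal (n + 1), t x.1 x.2 =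
      ∑ x ∈ antidiagonal n, t x.1 x.2 := by
    intro n
    -- Split 1 - q^(m+s) = (1 - q^s) + q^s(1 - q^m). After shifting indices, `h1` and `h2`
    -- contribute weights q^(b-m) and 1 - q^(b-m), which add up to 1.
    have e1 : (1 - q ^ (n + 1)) * ∑ x ∈ antidiagonal (n + 1), t x.1 x.2 =
        ∑ x ∈ antidiagonal (n + 1), (1 - q ^ x.2) * t x.1 x.2 +
        ∑ x ∈ antidiagonal (n + 1), q ^ x.2 * (1 - q ^ x.1) * t x.1 x.2 := by
      rw [mul_sum, ← sum_add_distrib]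
      refine sum_congr rfl fun x hx => ?_
      rw [← HasAntidiagonal.mem_antidiagonal.1 hx]
      ring
    rw [e1, Finset.Nat.sum_antidiagonal_succ', Finset.Nat.sum_antidiagonal_succ]
    simp only [h1, h2, pow_zero, sub_self, zero_mul, mul_zero, zero_add,
      ← sum_add_distrib]
    exact sum_congr rfl fun x _ => by ring
  have := eq_mul_of_recursion (g := fun n => ∑ x ∈ antidiagonal n, t x.1 x.2) hp hG a
  simp only [t] at this
  rw [this]
  simp [hp'.zero, mul_comm]

end Algebra

/-! ### Regrouping of sums and Euler's series -/

theorem hasSum_sum_fiber {ι κ M : Type*} [AddCommMonoid M] [TopologicalSpace M] [ContinuousAdd M]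
    [RegularSpace M] {f : ι → M} {a : M} (h : HasSum f a) (π : ι → κ) (s : κ → Finset ι)
    (hs : ∀ x k, x ∈ s k ↔ π x = k) : HasSum (fun k => ∑ x ∈ s k, f x) a :=
  ((Equiv.sigmaFiberEquiv π).hasSum_iff.2 h).sigma fun k =>
    (Equiv.subtypeEquivRight fun x => hs x k).hasSum_iff.1 ((s k).hasSum f)

section Topology

variable {R : Type*} [CommRing R] [TopologicalSpace R]

theorem summable_of_X_pow_dvd {ι : Type*} {f : ι → R⟦X⟧} (e : ι → ℕ)
    (he : ∀ d, {i | e i ≤ d}.Finite) (hf : ∀ i, X ^ e i ∣ f i) : Summable f := by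
  rw [WithPiTopology.summable_iff_summable_coeff]
  intro d
  refine summable_of_hasFiniteSupport ((he d).subset fun i hi => ?_)
  by_contra h
  exact hi (X_pow_dvd_iff.1 (hf i) d (not_le.1 h))

theorem multipliable_one_add_mul_pow (x : R⟦X⟧) {q : R⟦X⟧} (hq : X ∣ q) :
    Multipliable fun j : ℕ => 1 + x * q ^ j := by
  refine WithPiTopology.multipliable_one_add_of_tendsto_order_atTop_nhds_top R ?_
  rw [ENat.tendsto_nhds_top_iff_natCast_lt]
  refine fun n => eventually_atTop.2 ⟨n + 1, fun m hm => ?_⟩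
  refine lt_of_lt_of_le (Nat.cast_lt.2 hm) (le_order _ _ fun i hi => ?_)
  exact X_pow_dvd_iff.1 ((pow_dvd_pow_of_dvd hq m).mul_left x) i (by exact_mod_cast hi)

/-- The general term of Euler's series for `(-x; q)_∞`. -/
noncomputable def eulerTerm (q : R⟦X⟧) (p : ℕ → R⟦X⟧) (x : R⟦X⟧) (n : ℕ) : R⟦X⟧ :=
  x ^ n * q ^ n.choose 2 * p n

theorem X_pow_dvd_eulerTerm {R : Type*} [CommRing R] {q : R⟦X⟧} (p : ℕ → R⟦X⟧) {x : R⟦X⟧} (hx : X ∣ x) (n : ℕ) :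
    X ^ n ∣ eulerTerm q p x n :=
  ((pow_dvd_pow_of_dvd hx n).mul_right _).mul_right _

theorem summable_eulerTerm (q : R⟦X⟧) (p : ℕ → R⟦X⟧) {x : R⟦X⟧} (hx : X ∣ x) :
    Summable (eulerTerm q p x) :=
  summable_of_X_pow_dvd id (fun d => Set.finite_le_nat d) (X_pow_dvd_eulerTerm p hx)

variable [DiscreteTopology R]

/-- Functional equation F(x) = (1 + x) F(xq); iterating it peels off the factors of (-x;q)_∞. -/
theorem tsum_eulerTerm_eq {q : R⟦X⟧} {p : ℕ → R⟦X⟧} (hp : IsInvPoch q p) {x : R⟦X⟧}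
    (hx : X ∣ x) :
    ∑' n, eulerTerm q p x n = (1 + x) * ∑' n, eulerTerm q p (x * q) n := by
  have hs := summable_eulerTerm q p hx
  have hs' := summable_eulerTerm q p (hx.mul_right q)
  have h (n : ℕ) : eulerTerm q p x (n + 1) =
      eulerTerm q p (x * q) (n + 1) + x * eulerTerm q p (x * q) n := by
    simp only [eulerTerm]
    rw [← hp.succ n, Nat.choose_succ_succ' n 1, Nat.choose_one_right]
    ring
  rw [hs.tsum_eq_zero_add, add_mul, one_mul, ← hs'.tsum_mul_left]
  simp_rw [h]
  rw [((summable_nat_add_iff 1).2 hs').tsum_add (hs'.mul_left x), ← add_assoc]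
  congr 1
  rw [hs'.tsum_eq_zero_add]
  simp [eulerTerm]

theorem tsum_eulerTerm_eq_prod {q : R⟦X⟧} {p : ℕ → R⟦X⟧} (hp : IsInvPoch q p) {x : R⟦X⟧}
    (hx : X ∣ x) (N : ℕ) :
    ∑' n, eulerTerm q p x n =
      (∏ j ∈ range N, (1 + x * q ^ j)) * ∑' n, eulerTerm q p (x * q ^ N) n := by
  induction N with
  | zero => simp
  | succ N ih =>
    rw [ih, tsum_eulerTerm_eq hp (hx.mul_right _), prod_range_succ, pow_succ]
    ring_nf

theorem tendsto_tsum_eulerTerm {q : R⟦X⟧} (hq : X ∣ q) {p : ℕ → R⟦X⟧} (hp : p 0 = 1)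
    {x : R⟦X⟧} (hx : X ∣ x) :
    Tendsto (fun N => ∑' n, eulerTerm q p (x * q ^ N) n) atTop (𝓝 1) := by
  rw [WithPiTopology.tendsto_iff_coeff_tendsto]
  intro d
  refine tendsto_atTop_of_eventually_const (i₀ := d + 1) fun N hN => ?_
  have hs := summable_eulerTerm q p (hx.mul_right (q ^ N))
  rw [← ((WithPiTopology.hasSum_iff_hasSum_coeff R).1 hs.hasSum d).tsum_eq, tsum_eq_single 0]
  · simp [eulerTerm, hp]
  · intro n hn
    -- Since n ≥ 1 and N > d, only the n = 0 term reaches the coefficient of degree d.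
    have h1 : X ^ N ∣ (x * q ^ N) ^ n :=
      dvd_pow ((pow_dvd_pow_of_dvd hq N).mul_left x) hn
    exact X_pow_dvd_iff.1 ((h1.mul_right _).mul_right _) d hN

theorem hasSum_eulerTerm {q : R⟦X⟧} (hq : X ∣ q) {p : ℕ → R⟦X⟧} (hp : IsInvPoch q p)
    {x : R⟦X⟧} (hx : X ∣ x) : HasSum (eulerTerm q p x) (qPochInf (-x) q) := by
  have h1 := (multipliable_one_add_mul_pow x hq).hasProd.tendsto_prod_nat.mul
    (tendsto_tsum_eulerTerm hq hp.zero hx)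
  simp_rw [← tsum_eulerTerm_eq_prod hp hx, mul_one] at h1
  have h2 : qPochInf (-x) q = ∑' n, eulerTerm q p x n := by
    rw [tendsto_nhds_unique tendsto_const_nhds h1]
    simp [qPochInf]
  rw [h2]
  exact (summable_eulerTerm q p hx).hasSum

end Topology

/-! ### The exponent as a sum of binomials -/

theorem two_mul_cast_choose_two (n : ℕ) : 2 * (n.choose 2 : ℤ) = n * (n - 1) := by
  induction n with
  | zero => simp
  | succ n ih =>
    rw [Nat.choose_succ_succ' n 1, Nat.choose_one_right]
    push_cast
    linear_combination ih

theorem qExponent_eq (i j k l m : ℕ) :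
    qExponent i j k l m = (2 * i + k + m) + 2 * (2 * j + l + m) +
      3 * ((2 * i + k + m).choose 2 + (2 * j + l + m).choose 2 + k.choose 2 + l.choose 2 +
        (2 * i + k) * (2 * j + l)) := by
  zify
  rw [qExponent_cast]
  have h1 := two_mul_cast_choose_two (2 * i + k + m)
  have h2 := two_mul_cast_choose_two (2 * j + l + m)
  have h3 := two_mul_cast_choose_two k
  have h4 := two_mul_cast_choose_two l
  push_cast at h1 h2
  refine mul_left_cancel₀ (two_ne_zero (α := ℤ)) ?_
  linear_combination -3 * h1 - 3 * h2 - 3 * h3 - 3 * h4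

theorem finite_qExponent_le (d : ℕ) :
    {t : ℕ × ℕ × ℕ × ℕ × ℕ | qExponent t.1 t.2.1 t.2.2.1 t.2.2.2.1 t.2.2.2.2 ≤ d}.Finite := by
  refine (Set.finite_Iic ((d, d, d, d, d) : ℕ × ℕ × ℕ × ℕ × ℕ)).subset ?_
  rintro ⟨i, j, k, l, m⟩ h
  simp only [Set.mem_ofPred_eq, qExponent_eq] at h
  simp only [Set.mem_Iic, Prod.mk_le_mk]
  omega

/-! ### Three-stage summation -/

section InvPoch

variable (R : Type*) [CommRing R]

/-- The reciprocal of `(X ^ c; X ^ c)_n`. -/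
noncomputable def invPoch (c n : ℕ) : R⟦X⟧ :=
  invOfUnit (qPoch (X ^ c) (X ^ c) n) 1

theorem qPoch_mul_invPoch {c : ℕ} (hc : c ≠ 0) (n : ℕ) :
    qPoch (X ^ c : R⟦X⟧) (X ^ c) n * invPoch R c n = 1 := by
  apply mul_invOfUnit
  simp [qPoch, map_prod, hc]

theorem denomInv_eq (i j k l m : ℕ) :
    denomInv R i j k l m =
      invPoch R 3 k * invPoch R 3 l * invPoch R 3 m * invPoch R 6 i * invPoch R 6 j := by
  refine left_inv_eq_right_inv ((mul_comm _ _).trans (denom_mul_denomInv R i j k l m)) ?_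
  have h3 := qPoch_mul_invPoch R (c := 3) (by norm_num)
  have h6 := qPoch_mul_invPoch R (c := 6) (by norm_num)
  calc _ = (qPoch (X ^ 3 : R⟦X⟧) (X ^ 3) k * invPoch R 3 k) *
        (qPoch (X ^ 3 : R⟦X⟧) (X ^ 3) l * invPoch R 3 l) *
        (qPoch (X ^ 3 : R⟦X⟧) (X ^ 3) m * invPoch R 3 m) *
        (qPoch (X ^ 6 : R⟦X⟧) (X ^ 6) i * invPoch R 6 i) *
        (qPoch (X ^ 6 : R⟦X⟧) (X ^ 6) j * invPoch R 6 j) := by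
        simp only [denom]; ring
    _ = 1 := by simp only [h3, h6, one_mul]

variable {R} (a b : R)

/-- The monomial `x ^ A y ^ B Q ^ (A choose 2 + B choose 2)` with `x = a X`, `y = b X ^ 2` and
`Q = X ^ 3`. -/
noncomputable def eulerMonomial (A B : ℕ) : R⟦X⟧ :=
  (C a * X) ^ A * (X ^ 3) ^ A.choose 2 * ((C b * X ^ 2) ^ B * (X ^ 3) ^ B.choose 2)

/-- Once s, t, m are fixed, only the last bracket varies, and it is a product of an (i, k) part and
a (j, l) part. -/
theorem seriesTerm_eq (i j k l m : ℕ) :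
    seriesTerm a b (i, j, k, l, m) =
      eulerMonomial a b (2 * i + k + m) (2 * j + l + m) *
        ((X ^ 3) ^ ((2 * i + k) * (2 * j + l)) * invPoch R 3 m) *
        ((invPoch R 6 i * ((X ^ 3) ^ k.choose 2 * invPoch R 3 k)) *
          (invPoch R 6 j * ((X ^ 3) ^ l.choose 2 * invPoch R 3 l))) := by
  simp only [seriesTerm, denomInv_eq, qExponent_eq, eulerMonomial, map_mul, map_pow]
  ring

/-- The sum of the terms with `2 n21 + n11 = s`, `2 n22 + n12 = t` and `n10 = m`. -/
noncomputable def collectedTerm (x : ℕ × ℕ × ℕ) : R⟦X⟧ :=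
  eulerMonomial a b (x.1 + x.2.2) (x.2.1 + x.2.2) *
    ((X ^ 3) ^ (x.1 * x.2.1) * invPoch R 3 x.2.2) * (invPoch R 3 x.1 * invPoch R 3 x.2.1)

theorem sum_halves_invPoch_three (n : ℕ) :
    ∑ x ∈ halves n, invPoch R 6 x.1 * ((X ^ 3) ^ x.2.choose 2 * invPoch R 3 x.2) =
      invPoch R 3 n := by
  refine sum_halves_invPoch (qPoch_mul_invPoch R (by norm_num)) (fun n => ?_) n
  rw [← pow_mul]
  exact qPoch_mul_invPoch R (by norm_num) n

/-- The indices `(n21, n22, n11, n12, n10)` with `2 n21 + n11 = s`, `2 n22 + n12 = t` and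
`n10 = m`, where `x = (s, t, m)`. -/
def collectedIndices (x : ℕ × ℕ × ℕ) : Finset (ℕ × ℕ × ℕ × ℕ × ℕ) :=
  (halves x.1 ×ˢ halves x.2.1).image fun y => (y.1.1, y.2.1, y.1.2, y.2.2, x.2.2)

theorem mem_collectedIndices (t : ℕ × ℕ × ℕ × ℕ × ℕ) (x : ℕ × ℕ × ℕ) :
    t ∈ collectedIndices x ↔
      (2 * t.1 + t.2.2.1, 2 * t.2.1 + t.2.2.2.1, t.2.2.2.2) = x := by
  obtain ⟨i, j, k, l, m⟩ := t
  obtain ⟨u, v, w⟩ := x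
  simp only [collectedIndices, mem_image, mem_product, mem_halves, Prod.exists, Prod.mk.injEq]
  constructor
  · rintro ⟨i, k, j, l, ⟨h1, h2⟩, rfl, rfl, rfl, rfl, rfl⟩
    exact ⟨h1, h2, rfl⟩
  · rintro ⟨h1, h2, h3⟩
    exact ⟨i, k, j, l, ⟨h1, h2⟩, rfl, rfl, rfl, rfl, h3.symm⟩

theorem sum_collectedIndices (x : ℕ × ℕ × ℕ) :
    ∑ t ∈ collectedIndices x, seriesTerm a b t = collectedTerm a b x := by
  obtain ⟨u, v, m⟩ := x
  rw [collectedIndices, sum_image]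
  · rw [collectedTerm, ← sum_halves_invPoch_three u, ← sum_halves_invPoch_three v,
      sum_mul_sum, ← sum_product', mul_sum]
    refine sum_congr rfl ?_
    rintro ⟨⟨i, k⟩, j, l⟩ h
    simp only [mem_product, mem_halves] at h
    rw [seriesTerm_eq, h.1, h.2]
  · rintro ⟨⟨i, k⟩, j, l⟩ - ⟨⟨i', k'⟩, j', l'⟩ - h
    simp only [Prod.mk.injEq] at h ⊢
    tauto

/-- The triples `(s, t, m)` with `s + m = A` and `t + m = B`, where `x = (A, B)`. -/
def overlapIndices (x : ℕ × ℕ) : Finset (ℕ × ℕ × ℕ) :=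
  ((antidiagonal x.1).filter fun y => y.1 ≤ x.2).image fun y => (y.2, x.2 - y.1, y.1)

theorem mem_overlapIndices (t : ℕ × ℕ × ℕ) (x : ℕ × ℕ) :
    t ∈ overlapIndices x ↔ (t.1 + t.2.2, t.2.1 + t.2.2) = x := by
  obtain ⟨u, v, w⟩ := t
  obtain ⟨A, B⟩ := x
  simp only [overlapIndices, mem_image, mem_filter, HasAntidiagonal.mem_antidiagonal, Prod.exists,
    Prod.mk.injEq]
  constructor
  · rintro ⟨m, s, ⟨h1, h2⟩, rfl, rfl, rfl⟩
    omega
  · rintro ⟨h1, h2⟩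
    exact ⟨w, u, by omega, by omega, by omega, rfl⟩

theorem sum_overlapIndices (x : ℕ × ℕ) :
    ∑ t ∈ overlapIndices x, collectedTerm a b t =
      eulerTerm (X ^ 3) (invPoch R 3) (C a * X) x.1 *
        eulerTerm (X ^ 3) (invPoch R 3) (C b * X ^ 2) x.2 := by
  obtain ⟨A, B⟩ := x
  rw [overlapIndices, sum_image]
  · have h := sum_antidiagonal_invPoch (qPoch_mul_invPoch R (c := 3) (by norm_num)) A B
    rw [← sum_filter] at h
    calc _ = eulerMonomial a b A B * (invPoch R 3 A * invPoch R 3 B) := by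
          rw [← h, mul_sum]
          refine sum_congr rfl ?_
          rintro ⟨m, s⟩ h
          simp only [mem_filter, HasAntidiagonal.mem_antidiagonal] at h
          simp only [collectedTerm]
          rw [Nat.sub_add_cancel h.2, Nat.add_comm, h.1]
          ring
      _ = _ := by
          simp only [eulerMonomial, eulerTerm]
          ring
  · rintro ⟨m, s⟩ - ⟨m', s'⟩ - h
    simp only [Prod.mk.injEq] at h ⊢
    tauto

variable [TopologicalSpace R] [DiscreteTopology R]

theorem hasSum_seriesTerm :
    HasSum (seriesTerm a b)
      (qPochInf (-(C a * X)) (X ^ 3) * qPochInf (-(C b * X ^ 2)) (X ^ 3)) := by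
  have hq : (X : R⟦X⟧) ∣ X ^ 3 := dvd_pow_self X (by norm_num)
  have hx : X ∣ C a * X := dvd_mul_left X _
  have hy : X ∣ C b * X ^ 2 := (dvd_pow_self X (by norm_num)).mul_left _
  have hp := isInvPoch_of_mul_eq_one (qPoch_mul_invPoch R (c := 3) (by norm_num))
  -- Summability comes first: it licenses both regroupings, which preserve the sum, so the value can
  -- be read off at the end by uniqueness.
  have hs : Summable (seriesTerm a b) := by
    refine summable_of_X_pow_dvd _ finite_qExponent_le ?_
    rintro ⟨i, j, k, l, m⟩
    exact (dvd_mul_left _ _).mul_right _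
  have h := hasSum_sum_fiber hs.hasSum _ _ mem_collectedIndices
  simp_rw [sum_collectedIndices] at h
  have h := hasSum_sum_fiber h _ _ mem_overlapIndices
  simp_rw [sum_overlapIndices] at h
  have h' := (hasSum_eulerTerm hq hp hx).mul (hasSum_eulerTerm hq hp hy) h.summable
  rw [← h.unique h']
  exact hs.hasSum

end InvPoch

end SchurSeries

/-- Formal power series in `q = X` over `R`, with coefficientwise convergence: the two infinite
products converge, and the five-fold series converges to `(-aq; q³)_∞ (-bq²; q³)_∞`.
Taking `R = ℤ[a, b]` gives the identity with `a` and `b` indeterminates. -/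
theorem mainTheorem5 {R : Type*} [CommRing R] [TopologicalSpace R] [DiscreteTopology R]
    (a b : R) :
    Multipliable (fun j : ℕ =>
      (1 - (-(PowerSeries.C a * PowerSeries.X)) * (PowerSeries.X ^ 3) ^ j : R⟦X⟧)) ∧
    Multipliable (fun j : ℕ =>
      (1 - (-(PowerSeries.C b * PowerSeries.X ^ 2)) * (PowerSeries.X ^ 3) ^ j : R⟦X⟧)) ∧
    HasSum (SchurSeries.seriesTerm a b)
      (SchurSeries.qPochInf (-(PowerSeries.C a * PowerSeries.X)) (PowerSeries.X ^ 3)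
        * SchurSeries.qPochInf (-(PowerSeries.C b * PowerSeries.X ^ 2)) (PowerSeries.X ^ 3)) := by
  have hq : (PowerSeries.X : R⟦X⟧) ∣ PowerSeries.X ^ 3 := dvd_pow_self _ (by norm_num)
  refine ⟨?_, ?_, SchurSeries.hasSum_seriesTerm a b⟩
  · simpa only [neg_mul, sub_neg_eq_add] using SchurSeries.multipliable_one_add_mul_pow _ hq
  · simpa only [neg_mul, sub_neg_eq_add] using SchurSeries.multipliable_one_add_mul_pow _ hq
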